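/- **Setting.** A space of homogeneous type $(S,d,\mu)$ with constants $c_d,c_\mu\ge 1$ is a set $S$ with a function $d\colon S\times S\to[0,\infty)$ that is symmetric, vanishes exactly on the diagonal and satisfies $d(s,t)\le c_d\,(d(s,u)+d(u,t))$, together with a Borel measure $\mu$ such that every ball $B(s,\rho)=\{t: d(s,t)<\rho\}$, $\rho>0$, is a Borel set with $0<\mu(B(s,\rho))<\infty$ and $\mu(B(s,2\rho))\le c_\mu\,\mu(B(s,\rho))$. A *dyadic system* with parameters $0<c_0\le C_0<\infty$ and $0<\delta<1$ consists, for each $k\in\mathbb Z$, of a pairwise disjoint collection $\mathscr D_k$ of measurable sets with union $S$ such that for $k\ge l$, $Q\in\mathscr D_k$, $Q'\in\mathscr D_l$ either $Q\cap Q'=\varnothing$ or $Q\subseteq Q'$, and such that each $Q\in\mathscr D_k$ has a centre $z$ with $B(z,c_0\delta^k)\subseteq Q\subseteq B(z,C_0\delta^k)$. A *cube* is an element of some dyadic system with the parameters $c_0,C_0,\delta$; different cubes may come from different systems. A collection $\mathcal S$ of cubes is *$\eta$-sparse* if there are pairwise disjoint measurable sets $E_Q\subseteq Q$ ($Q\in\mathcal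 S$) with $\mu(E_Q)\ge\eta\,\mu(Q)$. For $g\ge 0$ measurable and $q>0$ put $\langle g\rangle_{q,Q}=\big(\frac1{\mu(Q)}\int_Q g^q\,d\mu\big)^{1/q}$. A *weight* is a locally integrable $w\colon S\to(0,\infty)$; for $1<t<\infty$ we write $w\in A_t$ if $$[w]_{A_t}=\sup_{B}\,\langle w\rangle_{1,B}\,\langle w^{-1}\rangle_{\frac1{t-1},B}<\infty,$$ the supremum being over all balls $B\subseteq S$. Finally $\|f\|_{L^p(S,w)}=\big(\int_S|f|^p\,w\,d\mu\big)^{1/p}$. **Proposition.** Let $(S,d,\mu)$ be a space of homogeneous type, let $\eta>0$, let $\mathcal S$ be an $\eta$-sparse collection of cubes with parameters $c_0,C_0,\delta$, and let $p_0,r\in[1,\infty)$. For all $p\in(p_0,\infty)$, $w\in A_{p/p_0}$ and $f\in L^p(S,w)$, $$\bigg\|\Big(\sum_{Q\in\mathcal S}\langle|f|\rangle_{p_0,Q}^r\,\mathbf 1_Q\Big)^{1/r}\bigg\|_{L^p(S,w)}\le C\,[w]_{A_{p/p_0}}^{\max\{\frac1{p-p_0},\frac1r\}}\,\|f\|_{L^p(S,w)},$$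 where the constant $C$ depends only on $c_d$, $c_\mu$, $p_0$, $p$, $r$, $\eta$ and (an upper bound for) the ratio $C_0/c_0$ of the parameters of the cubes. -/

import Mathlib

open MeasureTheory
open scoped ENNReal NNReal

noncomputable section

namespace HomType

/-- The ball `B(s, ρ) = {t | d(s, t) < ρ}`. -/
def ball {S : Type*} (d : S → S → ℝ) (s : S) (ρ : ℝ) : Set S := {t | d s t < ρ}

/-- `U` is open in the topology induced by `d`. -/
def IsQOpen {S : Type*} (d : S → S → ℝ) (U : Set S) : Prop :=
  ∀ s ∈ U, ∃ ρ : ℝ, 0 < ρ ∧ ball d s ρ ⊆ U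

/-- `d` is a quasi-metric on `S` with constant `cd`. -/
structure IsQuasiMetric {S : Type*} (d : S → S → ℝ) (cd : ℝ) : Prop where
  nonneg : ∀ s t, 0 ≤ d s t
  eq_zero_iff : ∀ s t, d s t = 0 ↔ s = t
  symm : ∀ s t, d s t = d t s
  quasi_triangle : ∀ s t u, d s t ≤ cd * (d s u + d u t)

/-- `(S, d, μ)` is a space of homogeneous type with quasi-metric constant `cd` and doubling
constant `cμ`: `μ` is a measure on the Borel `σ`-algebra of `(S, d)`, all balls are Borel sets
of positive finite measure, and `μ` is doubling. -/
structure IsHomogeneousType {S : Type*} [mS : MeasurableSpace S] (d : S → S → ℝ)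
    (μ : Measure S) (cd cμ : ℝ) : Prop where
  quasiMetric : IsQuasiMetric d cd
  borel : mS = MeasurableSpace.generateFrom {U | IsQOpen d U}
  measurableSet_ball : ∀ s ρ, MeasurableSet (ball d s ρ)
  measure_ball_pos : ∀ s ρ, 0 < ρ → 0 < μ (ball d s ρ)
  measure_ball_lt_top : ∀ s ρ, 0 < ρ → μ (ball d s ρ) < ∞
  doubling : ∀ s ρ, 0 < ρ → μ (ball d s (2 * ρ)) ≤ ENNReal.ofReal cμ * μ (ball d s ρ)

/-- `D`, with `D k` the collection of cubes of generation `k`, is a dyadic system with parameters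
`c₀`, `C₀`, `δ`. The cubes of one generation are nonempty and disjoint, so no index set is needed
to list them. -/
structure IsDyadicSystem {S : Type*} [MeasurableSpace S] (d : S → S → ℝ)
    (c₀ C₀ δ : ℝ) (D : ℤ → Set (Set S)) : Prop where
  measurableSet : ∀ k, ∀ Q ∈ D k, MeasurableSet Q
  disjoint : ∀ k, (D k).PairwiseDisjoint id
  cover : ∀ k, ⋃₀ D k = Set.univ
  nested : ∀ k l, l ≤ k → ∀ Q ∈ D k, ∀ Q' ∈ D l, Disjoint Q Q' ∨ Q ⊆ Q'
  sandwich : ∀ k, ∀ Q ∈ D k, ∃ z, ball d z (c₀ * δ ^ k) ⊆ Q ∧ Q ⊆ ball d z (C₀ * δ ^ k)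

/-- `Q` is a cube: an element of some dyadic system with parameters `c₀`, `C₀`, `δ`. -/
def IsCube {S : Type*} [MeasurableSpace S] (d : S → S → ℝ) (c₀ C₀ δ : ℝ) (Q : Set S) : Prop :=
  ∃ D : ℤ → Set (Set S), IsDyadicSystem d c₀ C₀ δ D ∧ ∃ k, Q ∈ D k

/-- The family of sets `Q i` is `η`-sparse. -/
def IsSparse {S ι : Type*} [MeasurableSpace S] (μ : Measure S) (η : ℝ) (Q : ι → Set S) : Prop :=
  ∃ E : ι → Set S, (∀ i, MeasurableSet (E i)) ∧ (∀ i, E i ⊆ Q i) ∧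
    (∀ i, ENNReal.ofReal η * μ (Q i) ≤ μ (E i)) ∧ Pairwise fun i j => Disjoint (E i) (E j)

/-- The average `⟨g⟩_{q,Q} = (μ(Q)⁻¹ ∫_Q g ^ q dμ) ^ (1/q)` of a nonnegative function `g`. -/
def avg {S : Type*} [MeasurableSpace S] (μ : Measure S) (q : ℝ) (Q : Set S)
    (g : S → ℝ≥0∞) : ℝ≥0∞ :=
  ((∫⁻ s in Q, g s ^ q ∂μ) / μ Q) ^ (1 / q)

/-- A weight: a locally integrable function with values in `(0, ∞)`. -/
def IsWeight {S : Type*} [MeasurableSpace S] (d : S → S → ℝ) (μ : Measure S)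
    (w : S → ℝ) : Prop :=
  (∀ s, 0 < w s) ∧ ∀ s ρ, 0 < ρ → IntegrableOn w (ball d s ρ) μ

open Classical in
/-- The Muckenhoupt characteristic `[w]_{A_p}`, for `1 ≤ p < ∞`, the supremum running over all
balls. -/
def apChar {S : Type*} [MeasurableSpace S] (d : S → S → ℝ) (μ : Measure S)
    (p : ℝ) (w : S → ℝ) : ℝ≥0∞ :=
  ⨆ (s : S) (ρ : ℝ) (_ : 0 < ρ),
    avg μ 1 (ball d s ρ) (fun t => ENNReal.ofReal (w t)) *
      (if p = 1 then essSup (fun t => (ENNReal.ofReal (w t))⁻¹) (μ.restrict (ball d s ρ))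
        else avg μ (1 / (p - 1)) (ball d s ρ) fun t => (ENNReal.ofReal (w t))⁻¹)

/-- The Muckenhoupt class `A_p`. -/
def MemAp {S : Type*} [MeasurableSpace S] (d : S → S → ℝ) (μ : Measure S)
    (p : ℝ) (w : S → ℝ) : Prop :=
  IsWeight d μ w ∧ apChar d μ p w < ∞

/-- The measure `w dμ`; `L^p(S, w)` is the `L^p` space of this measure. -/
def weighted {S : Type*} [MeasurableSpace S] (μ : Measure S) (w : S → ℝ) : Measure S :=
  μ.withDensity fun s => ENNReal.ofReal (w s)

open Classical in
/-- The `ℓ^r`-sparse operator `f ↦ (∑_Q ⟨|f|⟩_{p₀,Q} ^ r 1_Q) ^ (1/r)`, with values in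
`[0, ∞]`. -/
def sparseOp {S ι 𝕜 : Type*} [MeasurableSpace S] [RCLike 𝕜] (μ : Measure S) (p₀ r : ℝ)
    (Q : ι → Set S) (f : S → 𝕜) (s : S) : ℝ≥0∞ :=
  (∑' i, if s ∈ Q i then avg μ p₀ (Q i) (fun t => ‖f t‖ₑ) ^ r else 0) ^ (1 / r)

end HomType

end

/-! Put g = |f|^{p₀} and t = p/p₀, so that the summands are ⟨g⟩_{1,Q}^{r/p₀}. Since ℓ^s norms
decrease in s, the exponent r/p₀ may be lowered to ρ = min(r/p₀, t - 1)
(`tsum_rpow_rpow_le_of_exponent_le`).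

Let F = ∑ ⟨g⟩_{1,Q}^ρ 1_Q, let σ have density w^{-1/(t-1)}, and let q = t/ρ > 1. Pairing F with h =
F^{q-1} gives ∫ F^q w = ∑ ⟨g⟩_{1,Q}^ρ ∫_Q h w. Rewrite ⟨g⟩_{1,Q} through the σ-average of g
w^{1/(t-1)} and ∫_Q h w through the w-average of h, both normalised by the measure of a ball B ⊇ Q.
The leftover factor (σ(B)/μ(Q))^ρ w(B) is at most a constant times [w]_{A_t} σ(E)^{ρ/t}
w(E)^{1-ρ/t}, with the characteristic to the first power (`rpow_mul_le_of_muckenhoupt`). Hölder with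
q, q' leaves two sums over the disjoint sets E, each controlled by `carleson_embedding`. Hence the
L^q(w) norm of F is at most a constant times [w]_{A_t} times the ρ-th power of the L^t(w) norm of g;
the power t/(ρp) = 1/(ρp₀) of this is the claim.

The cubes need not be nested, and doubling of σ or w is not used: a Vitali covering argument with
averages over the enlarged balls replaces the dyadic maximal function. -/

namespace HomType

/-! ### Vitali coverings. -/

/-- Every finite subfamily of `Q` has a disjoint subfamily whose enlargements `B` cover it. -/
def HasVitaliCovering {S ι : Type*} (Q B : ι → Set S) : Prop :=
  ∀ s : Finset ι, ∃ u ⊆ s, (u : Set ι).PairwiseDisjoint Q ∧ ∀ i ∈ s, ∃ j ∈ u, Q i ⊆ B j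

theorem IsQuasiMetric.hasVitaliCovering {S ι : Type*} {d : S → S → ℝ} {cd : ℝ}
    (h : IsQuasiMetric d cd) (hcd : 1 ≤ cd)
    {Q : ι → Set S} {z : ι → S} {R : ι → ℝ} (hR : ∀ i, 0 < R i)
    (hne : ∀ i, (Q i).Nonempty) (hQ : ∀ i, Q i ⊆ ball d (z i) (R i)) :
    HasVitaliCovering Q fun i => ball d (z i) (5 * cd ^ 2 * R i) := by
  classical
  intro s
  obtain ⟨u, hus, hud, hu⟩ := Vitali.exists_disjoint_subfamily_covering_enlargement Q
    (s : Set ι) R 2 one_lt_two (fun i _ => (hR i).le) (∑ i ∈ s, R i)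
    (fun i hi => Finset.single_le_sum (fun j _ => (hR j).le) hi) fun i _ => hne i
  have hfin : u.Finite := s.finite_toSet.subset hus
  refine ⟨hfin.toFinset, by rwa [← Finset.coe_subset, hfin.coe_toFinset],
    by rwa [hfin.coe_toFinset], fun i hi => ?_⟩
  obtain ⟨j, hj, ⟨x, hxi, hxj⟩, hij⟩ := hu i hi
  refine ⟨j, hfin.mem_toFinset.2 hj, fun y hy => ?_⟩
  have h1 : d (z i) x < R i := hQ i hxi
  have h2 : d (z i) y < R i := hQ i hy
  have h3 : d (z j) x < R j := hQ j hxj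
  have h4 := h.quasi_triangle (z j) y x
  have h5 := h.quasi_triangle x y (z i)
  rw [h.symm x (z i)] at h5
  change d (z j) y < 5 * cd ^ 2 * R j
  -- Both points lie within R i ≤ 2 R j of z i. Passing through x to z j then costs (cd + 4 cd²) R
  -- j, whence the factor 5 cd².
  have h6 : d x y < cd * (4 * R j) := by nlinarith
  have h7 : d (z j) y < cd * (R j + cd * (4 * R j)) := by nlinarith
  have h8 : cd * R j ≤ cd ^ 2 * R j := by
    have := hR j
    gcongr
    nlinarith
  nlinarith

/-! ### Layer-cake formula and Carleson embedding. -/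

theorem lintegral_rpow_sub_one_lt (a : ℝ≥0∞) {q : ℝ} (hq : 0 < q) :
    ∫⁻ l in Set.Ioi (0 : ℝ), (if ENNReal.ofReal l < a then ENNReal.ofReal (l ^ (q - 1)) else 0)
      = a ^ q / ENNReal.ofReal q := by
  have hfin : ∀ b : ℝ, 0 ≤ b →
      ∫⁻ l in Set.Ioi (0 : ℝ),
        (if ENNReal.ofReal l < ENNReal.ofReal b then ENNReal.ofReal (l ^ (q - 1)) else 0)
      = ENNReal.ofReal b ^ q / ENNReal.ofReal q := by
    intro b hb
    have h1 : ∀ l ∈ Set.Ioi (0 : ℝ),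
        (if ENNReal.ofReal l < ENNReal.ofReal b then ENNReal.ofReal (l ^ (q - 1)) else 0)
          = (Set.Iio b).indicator (fun l => ENNReal.ofReal (l ^ (q - 1))) l := by
      intro l hl
      have hl' : 0 < l := hl
      by_cases h : l < b
      · rw [if_pos ((ENNReal.ofReal_lt_ofReal_iff (hl'.trans h)).2 h),
          Set.indicator_of_mem (by exact h)]
      · rw [if_neg (by
          rw [not_lt]; exact ENNReal.ofReal_le_ofReal (not_lt.1 h)), Set.indicator_of_notMem (by exact h)]
    rw [setLIntegral_congr_fun measurableSet_Ioi h1, setLIntegral_indicator measurableSet_Iio,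
      Set.inter_comm, Set.Ioi_inter_Iio]
    have hint : IntegrableOn (fun l : ℝ => l ^ (q - 1)) (Set.Ioo 0 b) := by
      have := (intervalIntegral.intervalIntegrable_rpow' (a := 0) (b := b)
        (r := q - 1) (by linarith))
      rw [intervalIntegrable_iff_integrableOn_Ioo_of_le hb] at this
      exact this
    rw [← ofReal_integral_eq_lintegral_ofReal hint
      ((ae_restrict_iff' measurableSet_Ioo).2 (Filter.Eventually.of_forall
        fun l hl => Real.rpow_nonneg hl.1.le _)),
      ← integral_Ioc_eq_integral_Ioo, ← intervalIntegral.integral_of_le hb,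
      integral_rpow (Or.inl (by linarith)), ENNReal.ofReal_rpow_of_nonneg hb hq.le,
      ← ENNReal.ofReal_div_of_pos hq]
    simp [Real.zero_rpow hq.ne']
  by_cases ha : a = ∞
  · subst ha
    rw [ENNReal.top_rpow_of_pos hq, ENNReal.top_div_of_ne_top ENNReal.ofReal_ne_top]
    refine ENNReal.eq_top_of_forall_nnreal_le fun r => ?_
    -- The height b = (r q)^{1/q} has b^q / q = r, so the integral over all heights exceeds every
    -- finite r.
    have h2 := hfin ((r * q : ℝ) ^ (1 / q)) (by positivity)
    rw [ENNReal.ofReal_rpow_of_nonneg (by positivity) hq.le, ← Real.rpow_mul (by positivity),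
      one_div_mul_cancel hq.ne', Real.rpow_one, ← ENNReal.ofReal_div_of_pos hq,
      mul_div_cancel_right₀ _ hq.ne', ENNReal.ofReal_coe_nnreal] at h2
    rw [← h2]
    refine lintegral_mono fun l => ?_
    split_ifs with h3 h4
    · exact le_rfl
    · exact absurd ENNReal.ofReal_lt_top h4
    · exact zero_le
    · exact zero_le
  · have := hfin a.toReal ENNReal.toReal_nonneg
    rwa [ENNReal.ofReal_toReal ha] at this

variable {S ι : Type*} [MeasurableSpace S]

/-- A weak-type bound. On each selected cube, discarding the values G ≤ l/2 loses at most l/2 ·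
ν(B), half of what the average condition provides. The selected cubes are disjoint, and their
enlargements cover all the sets E. Normalising by ν(B) rather than ν(Q) makes doubling of ν
unnecessary. -/
theorem sum_measure_lt_average_le (ν : Measure S) {Q B E : ι → Set S} (hE : ∀ i, MeasurableSet (E i))
    (hQ : ∀ i, MeasurableSet (Q i)) (hEQ : ∀ i, E i ⊆ Q i) (hQB : ∀ i, Q i ⊆ B i)
    (hdisj : Pairwise fun i j => Disjoint (E i) (E j)) (hfin : ∀ i, ν (B i) ≠ ∞)
    (hV : HasVitaliCovering Q B) {G : S → ℝ≥0∞} (hG : Measurable G) (s : Finset ι)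
    {l : ℝ≥0∞} (hl : l ≠ 0) (hl' : l ≠ ∞) :
    ∑ i ∈ s, (if l < (∫⁻ x in Q i, G x ∂ν) / ν (B i) then ν (E i) else 0)
      ≤ 2 / l * ∫⁻ x, (if l < 2 * G x then G x else 0) ∂ν := by
  classical
  rw [← Finset.sum_filter]
  set a := s.filter fun i => l < (∫⁻ x in Q i, G x ∂ν) / ν (B i) with ha
  set T : S → ℝ≥0∞ := fun x => if l < 2 * G x then G x else 0 with hT
  have hTm : Measurable T :=
    Measurable.ite (measurableSet_lt measurable_const (hG.const_mul 2)) hG measurable_const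
  obtain ⟨u, hua, hud, hcov⟩ := hV a
  have hl2 : l / 2 ≠ ∞ := ENNReal.div_ne_top hl' (by simp)
  have key : ∀ j ∈ u, l / 2 * ν (B j) ≤ ∫⁻ x in Q j, T x ∂ν := by
    intro j hj
    have h1 : l * ν (B j) ≤ ∫⁻ x in Q j, G x ∂ν := by
      have := (Finset.mem_filter.1 (hua hj)).2
      exact (ENNReal.mul_lt_of_lt_div this).le
    have h2 : ∫⁻ x in Q j, G x ∂ν ≤ ∫⁻ x in Q j, T x ∂ν + l / 2 * ν (B j) := by
      calc ∫⁻ x in Q j, G x ∂ν ≤ ∫⁻ x in Q j, (T x + l / 2) ∂ν := by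
            refine lintegral_mono fun x => ?_
            simp only [hT]
            split_ifs with h
            · exact le_self_add
            · rw [zero_add, ENNReal.le_div_iff_mul_le (by simp) (by simp), mul_comm]
              exact not_lt.1 h
        _ = ∫⁻ x in Q j, T x ∂ν + l / 2 * ν (Q j) := by
            rw [lintegral_add_left hTm, setLIntegral_const]
        _ ≤ _ := by gcongr; exact hQB j
    have h3 : l * ν (B j) = l / 2 * ν (B j) + l / 2 * ν (B j) := by
      rw [← add_mul, ENNReal.add_halves]
    rw [h3] at h1
    exact (ENNReal.add_le_add_iff_right (ENNReal.mul_ne_top hl2 (hfin j))).1 (h1.trans h2)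
  have hsum : l / 2 * ∑ i ∈ a, ν (E i) ≤ ∫⁻ x, T x ∂ν := by
    calc l / 2 * ∑ i ∈ a, ν (E i) = l / 2 * ν (⋃ i ∈ a, E i) := by
          rw [measure_biUnion_finset (fun i _ j _ h => hdisj h) fun i _ => hE i]
      _ ≤ l / 2 * ν (⋃ j ∈ u, B j) := by
          refine mul_le_mul_right (measure_mono fun x hx => ?_) _
          obtain ⟨i, hi, hxi⟩ := Set.mem_iUnion₂.1 hx
          obtain ⟨j, hj, hij⟩ := hcov i hi
          exact Set.mem_iUnion₂.2 ⟨j, hj, hij (hEQ i hxi)⟩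
      _ ≤ l / 2 * ∑ j ∈ u, ν (B j) := by gcongr; exact measure_biUnion_finset_le _ _
      _ ≤ ∑ j ∈ u, ∫⁻ x in Q j, T x ∂ν := by
          rw [Finset.mul_sum]; exact Finset.sum_le_sum key
      _ = ∫⁻ x in ⋃ j ∈ u, Q j, T x ∂ν :=
          (lintegral_biUnion_finset hud (fun j _ => hQ j) T).symm
      _ ≤ _ := setLIntegral_le_lintegral _ _
  calc ∑ i ∈ a, ν (E i) = 2 / l * (l / 2 * ∑ i ∈ a, ν (E i)) := by
        rw [← mul_assoc, ← ENNReal.inv_div (Or.inl (by simp)) (Or.inl (by simp)),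
          ENNReal.inv_mul_cancel _ hl2, one_mul]
        simp [hl]
    _ ≤ _ := by gcongr

/-- Integrating the weak-type bound against p l^{p-1} dl and exchanging integrals gives 2p G
(2G)^{p-1}/(p-1) pointwise, which is the stated constant times G^p. -/
theorem carleson_embedding (ν : Measure S) [SFinite ν] {Q B E : ι → Set S}
    (hE : ∀ i, MeasurableSet (E i))
    (hQ : ∀ i, MeasurableSet (Q i)) (hEQ : ∀ i, E i ⊆ Q i) (hQB : ∀ i, Q i ⊆ B i)
    (hdisj : Pairwise fun i j => Disjoint (E i) (E j)) (hfin : ∀ i, ν (B i) ≠ ∞)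
    (hV : HasVitaliCovering Q B) {G : S → ℝ≥0∞} (hG : Measurable G) (s : Finset ι)
    {p : ℝ} (hp : 1 < p) :
    ∑ i ∈ s, ((∫⁻ x in Q i, G x ∂ν) / ν (B i)) ^ p * ν (E i)
      ≤ ENNReal.ofReal (p * 2 ^ p / (p - 1)) * ∫⁻ x, G x ^ p ∂ν := by
  have hp0 : 0 < p := by linarith
  have hp1 : 0 < p - 1 := by linarith
  set a : ι → ℝ≥0∞ := fun i => (∫⁻ x in Q i, G x ∂ν) / ν (B i) with ha
  have hmeas : ∀ i, Measurable fun l : ℝ =>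
      (if ENNReal.ofReal l < a i then ENNReal.ofReal (l ^ (p - 1)) else 0) := fun i =>
    Measurable.ite (measurableSet_lt (by fun_prop) measurable_const) (by fun_prop) (by fun_prop)
  calc ∑ i ∈ s, a i ^ p * ν (E i)
      = ∑ i ∈ s, ENNReal.ofReal p * ((∫⁻ l in Set.Ioi (0 : ℝ),
          (if ENNReal.ofReal l < a i then ENNReal.ofReal (l ^ (p - 1)) else 0)) * ν (E i)) := by
        refine Finset.sum_congr rfl fun i _ => ?_
        rw [lintegral_rpow_sub_one_lt _ hp0, ← mul_assoc, ENNReal.mul_div_cancel (by simpa) (by simp)]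
    _ = ENNReal.ofReal p * ∫⁻ l in Set.Ioi (0 : ℝ), ∑ i ∈ s,
          (if ENNReal.ofReal l < a i then ENNReal.ofReal (l ^ (p - 1)) else 0) * ν (E i) := by
        rw [← Finset.mul_sum, lintegral_finsetSum _ fun i _ => (hmeas i).mul_const _]
        congr 1
        exact Finset.sum_congr rfl fun i _ => (lintegral_mul_const _ (hmeas i)).symm
    _ ≤ ENNReal.ofReal p * ∫⁻ l in Set.Ioi (0 : ℝ), ∫⁻ x, 2 * (G x *
          (if ENNReal.ofReal l < 2 * G x then ENNReal.ofReal (l ^ (p - 1 - 1)) else 0)) ∂ν := by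
        refine mul_le_mul_right ?_ _
        refine setLIntegral_mono' measurableSet_Ioi fun l hl => ?_
        have hl0 : 0 < l := hl
        have h1 := sum_measure_lt_average_le ν hE hQ hEQ hQB hdisj hfin hV hG s
          (l := ENNReal.ofReal l) (by simpa) (by simp)
        calc _ = ENNReal.ofReal (l ^ (p - 1)) *
              ∑ i ∈ s, (if ENNReal.ofReal l < a i then ν (E i) else 0) := by
              rw [Finset.mul_sum]
              refine Finset.sum_congr rfl fun i _ => ?_
              split_ifs <;> simp
          _ ≤ _ := mul_le_mul_right h1 _
          _ = (2 * ENNReal.ofReal (l ^ (p - 1 - 1))) *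
                ∫⁻ x, (if ENNReal.ofReal l < 2 * G x then G x else 0) ∂ν := by
              rw [← mul_assoc]
              congr 1
              rw [Real.rpow_sub_one hl0.ne' (p - 1), ENNReal.ofReal_div_of_pos hl0]
              simp only [div_eq_mul_inv]
              ring
          _ = _ := by
              rw [← lintegral_const_mul]
              · refine lintegral_congr fun x => ?_
                split_ifs
                · ring
                · simp
              · exact Measurable.ite (measurableSet_lt measurable_const (hG.const_mul 2)) hG
                  measurable_const
    _ = ENNReal.ofReal p * ∫⁻ x, (∫⁻ l in Set.Ioi (0 : ℝ), 2 * (G x *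
          (if ENNReal.ofReal l < 2 * G x then ENNReal.ofReal (l ^ (p - 1 - 1)) else 0))) ∂ν := by
        rw [lintegral_lintegral_swap]
        refine Measurable.aemeasurable ?_
        refine Measurable.const_mul (Measurable.mul (by fun_prop) ?_) _
        exact Measurable.ite (measurableSet_lt (by fun_prop) (by fun_prop)) (by fun_prop)
          (by fun_prop)
    _ = ENNReal.ofReal p * ∫⁻ x, 2 ^ p / ENNReal.ofReal (p - 1) * G x ^ p ∂ν := by
        congr 1
        refine lintegral_congr fun x => ?_
        have hm : Measurable fun l : ℝ =>
            (if ENNReal.ofReal l < 2 * G x then ENNReal.ofReal (l ^ (p - 1 - 1)) else 0) :=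
          Measurable.ite (measurableSet_lt (by fun_prop) measurable_const) (by fun_prop)
            (by fun_prop)
        rw [lintegral_const_mul _ (hm.const_mul _), lintegral_const_mul _ hm,
          lintegral_rpow_sub_one_lt _ hp1, ENNReal.mul_rpow_of_nonneg _ _ hp1.le]
        have h2 : ∀ y : ℝ≥0∞, y ^ p = y * y ^ (p - 1) := fun y => by
          conv_lhs => rw [show p = 1 + (p - 1) by ring,
            ENNReal.rpow_add_of_nonneg _ _ zero_le_one hp1.le, ENNReal.rpow_one]
        rw [h2 (G x), h2 2]
        simp only [div_eq_mul_inv]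
        ring
    _ = _ := by
        rw [lintegral_const_mul _ (by fun_prop), ← mul_assoc]
        congr 1
        rw [ENNReal.ofReal_div_of_pos hp1, ENNReal.ofReal_mul hp0.le,
          ← ENNReal.ofReal_rpow_of_nonneg (by norm_num) hp0.le]
        simp [mul_div_assoc]


/-! ### Sparse families and the dual weight. -/

/-- The sets `E i ⊆ Q i ⊆ B i` exhibit `Q` as a sparse family with Vitali enlargements `B` whose
measure is at most `D` times that of the disjoint sets `E`. -/
structure IsSparseFamily (μ : Measure S) (D : ℝ≥0∞) (Q B E : ι → Set S) : Prop where
  measurableSet_left : ∀ i, MeasurableSet (E i)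
  measurableSet : ∀ i, MeasurableSet (Q i)
  measurableSet_right : ∀ i, MeasurableSet (B i)
  subset_left : ∀ i, E i ⊆ Q i
  subset_right : ∀ i, Q i ⊆ B i
  disjoint : Pairwise fun i j => Disjoint (E i) (E j)
  vitali : HasVitaliCovering Q B
  measure_ne_zero : ∀ i, μ (B i) ≠ 0
  measure_ne_top : ∀ i, μ (B i) ≠ ∞
  measure_le : ∀ i, μ (B i) ≤ D * μ (E i)

/-- The measure dual to the weight `W` with respect to the class `A_t`. -/
noncomputable def dualMeasure (μ : Measure S) (t : ℝ) (W : S → ℝ≥0∞) : Measure S :=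
  μ.withDensity fun x => (W x)⁻¹ ^ (1 / (t - 1))

instance (μ : Measure S) [SFinite μ] (t : ℝ) (W : S → ℝ≥0∞) : SFinite (dualMeasure μ t W) := by
  unfold dualMeasure; infer_instance

section Dual

variable {μ : Measure S} {t : ℝ} {W : S → ℝ≥0∞}

theorem lintegral_dualMeasure (hW : Measurable W) {Q : Set S} (hQ : MeasurableSet Q)
    {G : S → ℝ≥0∞} (hG : Measurable G) :
    ∫⁻ x in Q, G x ∂dualMeasure μ t W = ∫⁻ x in Q, (W x)⁻¹ ^ (1 / (t - 1)) * G x ∂μ := by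
  rw [dualMeasure, setLIntegral_withDensity_eq_setLIntegral_mul _ (by fun_prop) hG hQ]
  rfl

/-- The factor W^{1/(t-1)} is the reciprocal of the density of the dual measure; it turns integrals
against μ into integrals against σ. -/
theorem lintegral_mul_rpow_dualMeasure (hW : Measurable W) (hW0 : ∀ x, W x ≠ 0)
    (hWt : ∀ x, W x ≠ ∞) {Q : Set S} (hQ : MeasurableSet Q) {g : S → ℝ≥0∞} (hg : Measurable g) :
    ∫⁻ x in Q, g x * W x ^ (1 / (t - 1)) ∂dualMeasure μ t W = ∫⁻ x in Q, g x ∂μ := by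
  rw [lintegral_dualMeasure hW hQ (by fun_prop)]
  refine lintegral_congr fun x => ?_
  rw [ENNReal.inv_rpow, mul_left_comm, ENNReal.inv_mul_cancel, mul_one]
  · simp [hW0, hWt, ENNReal.rpow_eq_zero_iff]
  · simp [hW0, hWt, ENNReal.rpow_eq_top_iff]

theorem lintegral_rpow_mul_rpow_dualMeasure (ht : 1 < t) (hW : Measurable W)
    (hW0 : ∀ x, W x ≠ 0) (hWt : ∀ x, W x ≠ ∞) {g : S → ℝ≥0∞} (hg : Measurable g) :
    ∫⁻ x, (g x * W x ^ (1 / (t - 1))) ^ t ∂dualMeasure μ t W = ∫⁻ x, g x ^ t * W x ∂μ := by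
  have h := lintegral_dualMeasure (μ := μ) (t := t) hW MeasurableSet.univ
    (G := fun x => (g x * W x ^ (1 / (t - 1))) ^ t) (by fun_prop)
  rw [Measure.restrict_univ, Measure.restrict_univ] at h
  rw [h]
  refine lintegral_congr fun x => ?_
  have ht1 : t - 1 ≠ 0 := by linarith
  rw [ENNReal.mul_rpow_of_nonneg _ _ (by linarith), ENNReal.inv_rpow, ← ENNReal.rpow_neg,
    mul_left_comm, ← ENNReal.rpow_mul, ← ENNReal.rpow_add _ _ (hW0 x) (hWt x)]
  congr 1
  rw [show -(1 / (t - 1)) + 1 / (t - 1) * t = 1 by field_simp; ring, ENNReal.rpow_one]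

theorem dualMeasure_ne_zero (hW : Measurable W) (hWt : ∀ x, W x ≠ ∞) (ht : 1 < t) {E : Set S}
    (hE : MeasurableSet E) (h : μ E ≠ 0) : dualMeasure μ t W E ≠ 0 := by
  rw [dualMeasure, withDensity_apply _ hE]
  refine (setLIntegral_pos_iff (by fun_prop)).2 ?_ |>.ne'
  have : Function.support (fun x => (W x)⁻¹ ^ (1 / (t - 1))) = Set.univ := by
    ext x
    simp [ENNReal.rpow_eq_zero_iff, hWt, ht.le]
  rw [this, Set.univ_inter]
  exact pos_iff_ne_zero.2 h

theorem withDensity_ne_zero (hW : Measurable W) (hW0 : ∀ x, W x ≠ 0) {E : Set S}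
    (hE : MeasurableSet E) (h : μ E ≠ 0) : μ.withDensity W E ≠ 0 := by
  rw [withDensity_apply _ hE]
  refine (setLIntegral_pos_iff hW).2 ?_ |>.ne'
  have : Function.support W = Set.univ := by
    ext x
    simp [hW0]
  rw [this, Set.univ_inter]
  exact pos_iff_ne_zero.2 h

/-- Hölder applied to 1 = W^{1/t} · W^{-1/t}. It moves the estimate from μ(E) to the σ- and
w-measures of the sparse part. -/
theorem measure_le_dualMeasure_mul (ht : 1 < t) (hW : Measurable W) (hW0 : ∀ x, W x ≠ 0)
    (hWt : ∀ x, W x ≠ ∞) {E : Set S} (hE : MeasurableSet E) :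
    μ E ≤ dualMeasure μ t W E ^ (1 - 1 / t) * μ.withDensity W E ^ (1 / t) := by
  have ht0 : 0 < t := by linarith
  have ht1 : 0 < t - 1 := by linarith
  have hc : t.HolderConjugate t.conjExponent := Real.HolderConjugate.conjExponent ht
  have h := ENNReal.lintegral_mul_le_Lp_mul_Lq (μ.restrict E) hc
    (f := fun x => W x ^ (1 / t)) (g := fun x => (W x)⁻¹ ^ (1 / t)) (by fun_prop) (by fun_prop)
  have h1 : ∀ x, W x ^ (1 / t) * (W x)⁻¹ ^ (1 / t) = 1 := fun x => by
    rw [ENNReal.inv_rpow, ENNReal.mul_inv_cancel]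
    · simp [hW0, hWt, ENNReal.rpow_eq_zero_iff]
    · simp [hW0, hWt, ENNReal.rpow_eq_top_iff]
  simp only [Pi.mul_apply, h1, ← ENNReal.rpow_mul, lintegral_const, one_mul,
    Measure.restrict_apply_univ] at h
  have e1 : 1 / t * t = 1 := by field_simp
  have e2 : 1 / t * t.conjExponent = 1 / (t - 1) := by
    rw [Real.conjExponent]; field_simp
  have e3 : 1 / t.conjExponent = 1 - 1 / t := by
    rw [Real.conjExponent]; field_simp
  rw [e1, e2, e3] at h
  simp only [ENNReal.rpow_one] at h
  rw [dualMeasure, withDensity_apply _ hE, withDensity_apply _ hE, mul_comm]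
  exact h

theorem lintegral_ne_top_of_lintegral_rpow {ν : Measure S} (ht : 1 < t) {Q : Set S}
    (hQ : ν Q ≠ ∞) {G : S → ℝ≥0∞} (hG : Measurable G) (h : ∫⁻ x, G x ^ t ∂ν ≠ ∞) :
    ∫⁻ x in Q, G x ∂ν ≠ ∞ := by
  have hc : t.HolderConjugate t.conjExponent := Real.HolderConjugate.conjExponent ht
  have h2 := ENNReal.lintegral_mul_le_Lp_mul_Lq (ν.restrict Q) hc
    (f := G) (g := fun _ => 1) (by fun_prop) (by fun_prop)
  simp only [Pi.mul_apply, mul_one, ENNReal.one_rpow, lintegral_const, one_mul,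
    Measure.restrict_apply_univ] at h2
  refine ne_top_of_le_ne_top (ENNReal.mul_ne_top ?_ ?_) h2
  · refine ENNReal.rpow_ne_top_of_nonneg (by have := hc.pos; positivity) ?_
    exact ne_top_of_le_ne_top h (setLIntegral_le_lintegral _ _)
  · exact ENNReal.rpow_ne_top_of_nonneg (by have := hc.symm.pos; positivity) hQ

end Dual

/-! ### The single-cube estimate and the bound for finite families. -/

/-- The quantitative form of the `A_t` condition used for a single cube, with the exponents
distributed over the sparse part. -/
theorem rpow_mul_le_of_muckenhoupt {t ρ : ℝ} (hρ : 0 < ρ) (hρt : ρ ≤ t - 1)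
    {A D sB wB mB mQ mE sE wE : ℝ≥0∞}
    (hA : wB / mB * (sB / mB) ^ (t - 1) ≤ A) (hmB : mB ≠ 0) (hmB' : mB ≠ ∞) (hsB : sB ≠ 0)
    (hsB' : sB ≠ ∞) (hs : sE ≤ sB) (hm : mB ≤ D * mE) (hmE : mE ≤ mQ)
    (hE : mE ≤ sE ^ (1 - 1 / t) * wE ^ (1 / t)) :
    (sB / mQ) ^ ρ * wB ≤ D ^ t * A * (sE ^ (ρ / t) * wE ^ (1 - ρ / t)) := by
  have ht1 : 0 < t - 1 := by linarith
  have ht0 : 0 < t := by linarith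
  have h1 : wB * sB ^ (t - 1) ≤ A * mB ^ t := by
    calc wB * sB ^ (t - 1) = wB / mB * (sB / mB) ^ (t - 1) * mB ^ t := by
          rw [show mB ^ t = mB * mB ^ (t - 1) by
            conv_lhs => rw [show t = 1 + (t - 1) by ring,
              ENNReal.rpow_add_of_nonneg _ _ zero_le_one ht1.le, ENNReal.rpow_one]]
          rw [mul_mul_mul_comm, ENNReal.div_mul_cancel hmB hmB',
            ← ENNReal.mul_rpow_of_nonneg _ _ ht1.le, ENNReal.div_mul_cancel hmB hmB']
      _ ≤ _ := by gcongr
  have h2 : mB ^ t ≤ D ^ t * mQ ^ ρ * (sB ^ (t - 1 - ρ) * (sE ^ (ρ / t) * wE ^ (1 - ρ / t))) := by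
    calc mB ^ t ≤ (D * mE) ^ t := by gcongr
      _ = D ^ t * (mE ^ ρ * mE ^ (t - ρ)) := by
          rw [ENNReal.mul_rpow_of_nonneg _ _ ht0.le,
            ← ENNReal.rpow_add_of_nonneg _ _ hρ.le (by linarith)]
          congr 2; ring
      _ ≤ D ^ t * (mQ ^ ρ * (sE ^ (1 - 1 / t) * wE ^ (1 / t)) ^ (t - ρ)) := by
          have : 0 ≤ t - ρ := by linarith
          gcongr
      _ = D ^ t * (mQ ^ ρ * (sE ^ (t - 1 - ρ) * (sE ^ (ρ / t) * wE ^ (1 - ρ / t)))) := by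
          -- The exponent of sE splits as (1 - 1/t)(t - ρ) = (t - 1 - ρ) + ρ/t. The part t - 1 - ρ
          -- is then enlarged to sB, which requires ρ ≤ t - 1, and cancels against sB^{t-1}.
          congr 2
          rw [ENNReal.mul_rpow_of_nonneg _ _ (by linarith), ← ENNReal.rpow_mul,
            ← ENNReal.rpow_mul, ← mul_assoc,
            ← ENNReal.rpow_add_of_nonneg _ _ (by linarith) (by positivity)]
          congr 2 <;> field_simp
          ring
      _ ≤ D ^ t * (mQ ^ ρ * (sB ^ (t - 1 - ρ) * (sE ^ (ρ / t) * wE ^ (1 - ρ / t)))) := by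
          have : 0 ≤ t - 1 - ρ := by linarith
          gcongr
      _ = _ := by ring
  have hpos : sB ^ (t - 1 - ρ) ≠ 0 := by
    simp [ENNReal.rpow_eq_zero_iff, hsB, hsB']
  have htop : sB ^ (t - 1 - ρ) ≠ ∞ := by
    simp [ENNReal.rpow_eq_top_iff, hsB, hsB']
  have h3 : sB ^ ρ * wB ≤ mQ ^ ρ * (D ^ t * A * (sE ^ (ρ / t) * wE ^ (1 - ρ / t))) := by
    refine (ENNReal.mul_le_mul_iff_right hpos htop).1 ?_
    calc sB ^ (t - 1 - ρ) * (sB ^ ρ * wB) = wB * sB ^ (t - 1) := by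
          rw [← mul_assoc, ← ENNReal.rpow_add_of_nonneg _ _ (by linarith) hρ.le, mul_comm]
          congr 2; ring
      _ ≤ A * mB ^ t := h1
      _ ≤ A * (D ^ t * mQ ^ ρ * (sB ^ (t - 1 - ρ) * (sE ^ (ρ / t) * wE ^ (1 - ρ / t)))) := by
          gcongr
      _ = _ := by ring
  rw [ENNReal.div_rpow_of_nonneg _ _ hρ.le, ENNReal.mul_div_right_comm.symm]
  exact ENNReal.div_le_of_le_mul' h3

/-- The constant of the finite sparse bound. -/
noncomputable def sparseConst (t ρ : ℝ) (D : ℝ≥0∞) : ℝ≥0∞ :=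
  D ^ t * ENNReal.ofReal (t * 2 ^ t / (t - 1)) ^ (1 / (t / ρ)) *
    ENNReal.ofReal ((t / ρ).conjExponent * 2 ^ (t / ρ).conjExponent /
      ((t / ρ).conjExponent - 1)) ^ (1 / (t / ρ).conjExponent)

/-- Since h = F^{q-1} has ∫ h^{q'} dw = ∫ F^q dw = X, duality bounds X by a multiple of X^{1/q'}.
Dividing needs X finite, which is why the family is finite here. -/
theorem lintegral_sum_indicator_rpow_le {μ : Measure S} [SFinite μ] {D : ℝ≥0∞}
    {Q B E : ι → Set S} (hF : IsSparseFamily μ D Q B E) {t ρ : ℝ} (hρ : 0 < ρ)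
    (hρt : ρ ≤ t - 1) {W : S → ℝ≥0∞} (hW : Measurable W) (hW0 : ∀ x, W x ≠ 0)
    (hWt : ∀ x, W x ≠ ∞) (hwB : ∀ i, μ.withDensity W (B i) ≠ ∞) {A : ℝ≥0∞} (hAt : A ≠ ∞)
    (hA : ∀ i, μ.withDensity W (B i) / μ (B i) *
      (dualMeasure μ t W (B i) / μ (B i)) ^ (t - 1) ≤ A)
    {g : S → ℝ≥0∞} (hg : Measurable g) (hgt : ∫⁻ x, g x ^ t * W x ∂μ ≠ ∞) (s : Finset ι) :
    ∫⁻ x, (∑ i ∈ s, (Q i).indicator (fun _ => ((∫⁻ y in Q i, g y ∂μ) / μ (Q i)) ^ ρ) x) ^ (t / ρ)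
        ∂μ.withDensity W
      ≤ (sparseConst t ρ D * A) ^ (t / ρ) * ∫⁻ x, g x ^ t * W x ∂μ := by
  have ht : 1 < t := by linarith
  have ht0 : 0 < t := by linarith
  have ht1 : 0 < t - 1 := by linarith
  have hq : 1 < t / ρ := by rw [lt_div_iff₀ hρ]; linarith
  set q := t / ρ with hqdef
  have hq0 : 0 < q := by linarith
  have hc : q.HolderConjugate q.conjExponent := Real.HolderConjugate.conjExponent hq
  set q' := q.conjExponent with hq'
  have hq'1 : 1 < q' := hc.symm.lt
  have hq'0 : 0 < q' := by linarith
  set w := μ.withDensity W with hw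
  set σ := dualMeasure μ t W with hσ
  set G : S → ℝ≥0∞ := fun x => g x * W x ^ (1 / (t - 1)) with hGdef
  have hG : Measurable G := by fun_prop
  have hGt : ∫⁻ x, G x ^ t ∂σ = ∫⁻ x, g x ^ t * W x ∂μ :=
    lintegral_rpow_mul_rpow_dualMeasure ht hW hW0 hWt hg
  have hGQ : ∀ i, ∫⁻ x in Q i, G x ∂σ = ∫⁻ x in Q i, g x ∂μ := fun i =>
    lintegral_mul_rpow_dualMeasure hW hW0 hWt (hF.measurableSet i) hg
  have hwB0 : ∀ i, w (B i) ≠ 0 := fun i =>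
    withDensity_ne_zero hW hW0 (hF.measurableSet_right i) (hF.measure_ne_zero i)
  have hσB0 : ∀ i, σ (B i) ≠ 0 := fun i =>
    dualMeasure_ne_zero hW hWt ht (hF.measurableSet_right i) (hF.measure_ne_zero i)
  -- As w(B) > 0, an infinite σ(B) would make the A_t product infinite.
  have hσBt : ∀ i, σ (B i) ≠ ∞ := by
    intro i h
    have := hA i
    rw [h, ENNReal.top_div_of_ne_top (hF.measure_ne_top i), ENNReal.top_rpow_of_pos ht1,
      ENNReal.mul_top] at this
    · exact hAt (top_le_iff.1 this)
    · exact (ENNReal.div_ne_zero).2 ⟨hwB0 i, hF.measure_ne_top i⟩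
  have hterm : ∀ i, (σ (B i) / μ (Q i)) ^ ρ * w (B i)
      ≤ D ^ t * A * (σ (E i) ^ (ρ / t) * w (E i) ^ (1 - ρ / t)) := fun i =>
    rpow_mul_le_of_muckenhoupt hρ hρt (hA i) (hF.measure_ne_zero i) (hF.measure_ne_top i)
      (hσB0 i) (hσBt i) (measure_mono ((hF.subset_left i).trans (hF.subset_right i)))
      (hF.measure_le i) (measure_mono (hF.subset_left i))
      (measure_le_dualMeasure_mul ht hW hW0 hWt (hF.measurableSet_left i))
  set c : ι → ℝ≥0∞ := fun i => ((∫⁻ y in Q i, g y ∂μ) / μ (Q i)) ^ ρ with hcdef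
  have hμQ0 : ∀ i, μ (Q i) ≠ 0 := by
    intro i h
    have := (hF.measure_le i).trans (mul_le_mul_right (measure_mono (hF.subset_left i)) D)
    rw [h, mul_zero] at this
    exact hF.measure_ne_zero i (nonpos_iff_eq_zero.1 this)
  have hct : ∀ i, c i ≠ ∞ := by
    intro i
    refine ENNReal.rpow_ne_top_of_nonneg hρ.le (ENNReal.div_ne_top ?_ (hμQ0 i))
    rw [← hGQ i]
    refine lintegral_ne_top_of_lintegral_rpow ht ?_ hG (by rwa [hGt])
    exact ne_top_of_le_ne_top (hσBt i) (measure_mono (hF.subset_right i))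
  set F : S → ℝ≥0∞ := fun x => ∑ i ∈ s, (Q i).indicator (fun _ => c i) x with hFdef
  have hFm : Measurable F := Finset.measurable_fun_sum _ fun i _ =>
    measurable_const.indicator (hF.measurableSet i)
  set X := ∫⁻ x, F x ^ q ∂w with hX
  have hXt : X ≠ ∞ := by
    -- F is at most the sum of all coefficients and vanishes off the union of the cubes.
    have hle : X ≤ ∑ i ∈ s, (∑ j ∈ s, c j) ^ q * w (Q i) := by
      calc X ≤ ∫⁻ x, ∑ i ∈ s, (Q i).indicator (fun _ => (∑ j ∈ s, c j) ^ q) x ∂w := by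
            refine lintegral_mono fun x => ?_
            by_cases hx : ∃ i ∈ s, x ∈ Q i
            · obtain ⟨i, hi, hxi⟩ := hx
              calc F x ^ q ≤ (∑ j ∈ s, c j) ^ q := by
                    gcongr
                    exact Finset.sum_le_sum fun j _ => Set.indicator_le_self' (by simp) _
                _ = (Q i).indicator (fun _ => (∑ j ∈ s, c j) ^ q) x := by
                    rw [Set.indicator_of_mem hxi]
                _ ≤ _ := Finset.single_le_sum
                    (f := fun i => (Q i).indicator (fun _ => (∑ j ∈ s, c j) ^ q) x)
                    (fun _ _ => zero_le) hi
            · push Not at hx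
              have : F x = 0 := Finset.sum_eq_zero fun i hi =>
                Set.indicator_of_notMem (hx i hi) _
              rw [this, ENNReal.zero_rpow_of_pos hq0]
              exact zero_le
        _ = _ := by
            rw [lintegral_finsetSum _ fun i _ => measurable_const.indicator (hF.measurableSet i)]
            refine Finset.sum_congr rfl fun i _ => ?_
            rw [lintegral_indicator (hF.measurableSet i), setLIntegral_const]
    refine ne_top_of_le_ne_top (ENNReal.sum_ne_top.2 fun i _ => ENNReal.mul_ne_top ?_ ?_) hle
    · exact ENNReal.rpow_ne_top_of_nonneg hq0.le (ENNReal.sum_ne_top.2 fun j _ => hct j)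
    · exact ne_top_of_le_ne_top (hwB i) (measure_mono (hF.subset_right i))
  set h : S → ℝ≥0∞ := fun x => F x ^ (q - 1) with hh
  have hhm : Measurable h := by fun_prop
  set a : ι → ℝ≥0∞ := fun i => (∫⁻ x in Q i, G x ∂σ) / σ (B i) with ha
  set b : ι → ℝ≥0∞ := fun i => (∫⁻ x in Q i, h x ∂w) / w (B i) with hb
  have hρq : ρ / t = 1 / q := by rw [hqdef]; field_simp
  have hρq' : 1 - ρ / t = 1 / q' := by
    have := hc.inv_add_inv_eq_one
    rw [hρq, one_div, one_div]; linarith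
  have hXsum : X = ∑ i ∈ s, c i * ∫⁻ x in Q i, h x ∂w := by
    calc X = ∫⁻ x, ∑ i ∈ s, (Q i).indicator (fun x => c i * h x) x ∂w := by
          refine lintegral_congr fun x => ?_
          rw [show F x ^ q = F x * h x by
            simp only [hh]
            conv_lhs => rw [show q = 1 + (q - 1) by ring,
              ENNReal.rpow_add_of_nonneg _ _ zero_le_one (by linarith), ENNReal.rpow_one]]
          simp only [hFdef]
          rw [Finset.sum_mul]
          exact Finset.sum_congr rfl fun i _ => (Set.indicator_mul_left _ _ _).symm
      _ = _ := by
          rw [lintegral_finsetSum _ fun i _ =>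
            (hhm.const_mul _).indicator (hF.measurableSet i)]
          refine Finset.sum_congr rfl fun i _ => ?_
          rw [lintegral_indicator (hF.measurableSet i), lintegral_const_mul _ hhm]
  have hbound : X ≤ D ^ t * A *
      ((ENNReal.ofReal (t * 2 ^ t / (t - 1)) * ∫⁻ x, G x ^ t ∂σ) ^ (1 / q) *
      (ENNReal.ofReal (q' * 2 ^ q' / (q' - 1)) * ∫⁻ x, h x ^ q' ∂w) ^ (1 / q')) := by
    calc X = ∑ i ∈ s, a i ^ ρ * b i * ((σ (B i) / μ (Q i)) ^ ρ * w (B i)) := by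
          rw [hXsum]
          refine Finset.sum_congr rfl fun i _ => ?_
          have e1 : c i = a i ^ ρ * (σ (B i) / μ (Q i)) ^ ρ := by
            rw [← ENNReal.mul_rpow_of_nonneg _ _ hρ.le]
            simp only [hcdef, ha]
            rw [← hGQ i, ← mul_div_assoc, ENNReal.div_mul_cancel (hσB0 i) (hσBt i)]
          have e2 : ∫⁻ x in Q i, h x ∂w = b i * w (B i) :=
            (ENNReal.div_mul_cancel (hwB0 i) (hwB i)).symm
          rw [e1, e2]
          ring
      _ ≤ ∑ i ∈ s, a i ^ ρ * b i * (D ^ t * A * (σ (E i) ^ (ρ / t) * w (E i) ^ (1 - ρ / t))) :=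
          Finset.sum_le_sum fun i _ => mul_le_mul_right (hterm i) _
      _ = D ^ t * A *
            ∑ i ∈ s, (a i ^ ρ * σ (E i) ^ (ρ / t)) * (b i * w (E i) ^ (1 - ρ / t)) := by
          rw [Finset.mul_sum]
          exact Finset.sum_congr rfl fun i _ => by ring
      _ ≤ D ^ t * A * ((∑ i ∈ s, (a i ^ ρ * σ (E i) ^ (ρ / t)) ^ q) ^ (1 / q) *
            (∑ i ∈ s, (b i * w (E i) ^ (1 - ρ / t)) ^ q') ^ (1 / q')) :=
          mul_le_mul_right (ENNReal.inner_le_Lp_mul_Lq s _ _ hc) _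
      _ = D ^ t * A * ((∑ i ∈ s, a i ^ t * σ (E i)) ^ (1 / q) *
            (∑ i ∈ s, b i ^ q' * w (E i)) ^ (1 / q')) := by
          have e1 : ∀ i, (a i ^ ρ * σ (E i) ^ (ρ / t)) ^ q = a i ^ t * σ (E i) := fun i => by
            rw [ENNReal.mul_rpow_of_nonneg _ _ hq0.le, ← ENNReal.rpow_mul, ← ENNReal.rpow_mul,
              hρq, one_div_mul_cancel hq0.ne', ENNReal.rpow_one, hqdef,
              mul_div_cancel₀ _ hρ.ne']
          have e2 : ∀ i, (b i * w (E i) ^ (1 - ρ / t)) ^ q' = b i ^ q' * w (E i) := fun i => by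
            rw [ENNReal.mul_rpow_of_nonneg _ _ hq'0.le, ← ENNReal.rpow_mul, hρq',
              one_div_mul_cancel hq'0.ne', ENNReal.rpow_one]
          simp only [e1, e2]
      _ ≤ _ := by
          gcongr
          · exact carleson_embedding σ hF.measurableSet_left hF.measurableSet hF.subset_left
              hF.subset_right hF.disjoint hσBt hF.vitali hG s ht
          · exact carleson_embedding w hF.measurableSet_left hF.measurableSet hF.subset_left
              hF.subset_right hF.disjoint hwB hF.vitali hhm s hq'1
  have hhq : ∫⁻ x, h x ^ q' ∂w = X := by
    refine lintegral_congr fun x => ?_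
    simp only [hh]
    rw [← ENNReal.rpow_mul, hc.sub_one_mul_conj]
  rw [hhq, hGt, ENNReal.mul_rpow_of_nonneg _ _ (by positivity),
    ENNReal.mul_rpow_of_nonneg _ X (by positivity)] at hbound
  by_cases hX0 : X = 0
  · rw [hX0]; exact zero_le
  have hfin : X ^ (1 / q) ≤ sparseConst t ρ D * A * (∫⁻ x, g x ^ t * W x ∂μ) ^ (1 / q) := by
    refine (ENNReal.mul_le_mul_iff_left (c := X ^ (1 / q')) ?_ ?_).1 ?_
    · simp [ENNReal.rpow_eq_zero_iff, hX0, hXt]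
    · simp [ENNReal.rpow_eq_top_iff, hX0, hXt]
    · rw [← ENNReal.rpow_add _ _ hX0 hXt]
      have : 1 / q + 1 / q' = 1 := by rw [one_div, one_div]; exact hc.inv_add_inv_eq_one
      rw [this, ENNReal.rpow_one]
      refine hbound.trans_eq ?_
      rw [sparseConst]
      ring
  calc X = (X ^ (1 / q)) ^ q := by
        rw [← ENNReal.rpow_mul, one_div_mul_cancel hq0.ne', ENNReal.rpow_one]
    _ ≤ _ := ENNReal.rpow_le_rpow hfin hq0.le
    _ = _ := by
        rw [ENNReal.mul_rpow_of_nonneg _ _ hq0.le, ← ENNReal.rpow_mul _ (1 / q),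
          one_div_mul_cancel hq0.ne', ENNReal.rpow_one]


/-! ### Countable families and change of exponent. -/

theorem sparseConst_ne_top {t ρ : ℝ} (hρ : 0 < ρ) (hρt : ρ ≤ t - 1) {D : ℝ≥0∞} (hD : D ≠ ∞) :
    sparseConst t ρ D ≠ ∞ := by
  have hq : 1 < t / ρ := by rw [lt_div_iff₀ hρ]; linarith
  have hc : (t / ρ).HolderConjugate (t / ρ).conjExponent := Real.HolderConjugate.conjExponent hq
  refine ENNReal.mul_ne_top (ENNReal.mul_ne_top ?_ ?_) ?_
  · exact ENNReal.rpow_ne_top_of_nonneg (by linarith) hD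
  · exact ENNReal.rpow_ne_top_of_nonneg (by have := hc.pos; positivity) ENNReal.ofReal_ne_top
  · exact ENNReal.rpow_ne_top_of_nonneg (by have := hc.symm.pos; positivity) ENNReal.ofReal_ne_top

/-- Monotone convergence: the finite bound is uniform in the subfamily. Countability makes the
supremum over finite subfamilies a countable one. -/
theorem lintegral_tsum_indicator_rpow_le [Countable ι] {μ : Measure S} [SFinite μ] {D : ℝ≥0∞}
    {Q B E : ι → Set S} (hF : IsSparseFamily μ D Q B E) {t ρ : ℝ} (hρ : 0 < ρ)
    (hρt : ρ ≤ t - 1) {W : S → ℝ≥0∞} (hW : Measurable W) (hW0 : ∀ x, W x ≠ 0)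
    (hWt : ∀ x, W x ≠ ∞) (hwB : ∀ i, μ.withDensity W (B i) ≠ ∞) {A : ℝ≥0∞} (hAt : A ≠ ∞)
    (hA : ∀ i, μ.withDensity W (B i) / μ (B i) *
      (dualMeasure μ t W (B i) / μ (B i)) ^ (t - 1) ≤ A)
    {g : S → ℝ≥0∞} (hg : Measurable g) (hgt : ∫⁻ x, g x ^ t * W x ∂μ ≠ ∞) :
    ∫⁻ x, (∑' i, (Q i).indicator (fun _ => ((∫⁻ y in Q i, g y ∂μ) / μ (Q i)) ^ ρ) x) ^ (t / ρ)
        ∂μ.withDensity W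
      ≤ (sparseConst t ρ D * A) ^ (t / ρ) * ∫⁻ x, g x ^ t * W x ∂μ := by
  have hq0 : 0 < t / ρ := div_pos (by linarith) hρ
  have hsup : ∀ x, (∑' i, (Q i).indicator
        (fun _ => ((∫⁻ y in Q i, g y ∂μ) / μ (Q i)) ^ ρ) x) ^ (t / ρ)
      = ⨆ s : Finset ι, (∑ i ∈ s, (Q i).indicator
        (fun _ => ((∫⁻ y in Q i, g y ∂μ) / μ (Q i)) ^ ρ) x) ^ (t / ρ) := fun x => by
    rw [ENNReal.tsum_eq_iSup_sum]
    exact OrderIso.map_iSup (ENNReal.orderIsoRpow _ hq0) _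
  simp only [hsup]
  rw [lintegral_iSup_directed]
  · exact iSup_le fun s =>
      lintegral_sum_indicator_rpow_le hF hρ hρt hW hW0 hWt hwB hAt hA hg hgt s
  · intro s
    exact ((Finset.measurable_fun_sum _ fun i _ =>
      measurable_const.indicator (hF.measurableSet i)).pow_const _).aemeasurable
  · refine Monotone.directed_le fun s u hsu x => ?_
    exact ENNReal.rpow_le_rpow (Finset.sum_le_sum_of_subset hsu) hq0.le

/-- Each b i is at most the ℓ^ρ norm T, so b i ^ u ≤ T^{u-ρ} b i ^ ρ. -/
theorem tsum_rpow_rpow_le_of_exponent_le (b : ι → ℝ≥0∞) {ρ u : ℝ} (hρ : 0 < ρ) (hu : ρ ≤ u) :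
    (∑' i, b i ^ u) ^ (1 / u) ≤ (∑' i, b i ^ ρ) ^ (1 / ρ) := by
  have hu0 : 0 < u := hρ.trans_le hu
  set T := (∑' i, b i ^ ρ) ^ (1 / ρ) with hT
  have hTρ : ∑' i, b i ^ ρ = T ^ ρ := by
    rw [hT, ← ENNReal.rpow_mul, one_div_mul_cancel hρ.ne', ENNReal.rpow_one]
  have hb : ∀ i, b i ≤ T := fun i => by
    rw [← ENNReal.rpow_le_rpow_iff hρ, ← hTρ]
    exact ENNReal.le_tsum i
  have hsplit : ∀ y : ℝ≥0∞, y ^ u = y ^ (u - ρ) * y ^ ρ := fun y => by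
    rw [← ENNReal.rpow_add_of_nonneg _ _ (sub_nonneg.2 hu) hρ.le, sub_add_cancel]
  rw [one_div, ENNReal.rpow_inv_le_iff hu0, hsplit T, ← hTρ, ← ENNReal.tsum_mul_left]
  refine ENNReal.tsum_le_tsum fun i => ?_
  rw [hsplit]
  have : 0 ≤ u - ρ := sub_nonneg.2 hu
  gcongr
  exact hb i

/-! ### Geometry of homogeneous spaces and measurability of weights. -/

section Geometry

variable {d : S → S → ℝ} {μ : Measure S} {cd cμ : ℝ}

theorem IsHomogeneousType.sigmaFinite (h : IsHomogeneousType d μ cd cμ) : SigmaFinite μ := by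
  rcases isEmpty_or_nonempty S with hS | ⟨⟨s⟩⟩
  · rw [Measure.eq_zero_of_isEmpty μ]; infer_instance
  · refine ⟨⟨⟨fun n : ℕ => ball d s (n + 1), fun _ => trivial,
      fun n => h.measure_ball_lt_top s _ (by positivity), ?_⟩⟩⟩
    refine Set.eq_univ_of_forall fun x => ?_
    obtain ⟨n, hn⟩ := exists_nat_gt (d s x)
    exact Set.mem_iUnion.2 ⟨n, show d s x < n + 1 by linarith⟩

theorem IsHomogeneousType.measure_ball_two_pow_mul_le (h : IsHomogeneousType d μ cd cμ) (z : S)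
    {R : ℝ} (hR : 0 < R) (N : ℕ) :
    μ (ball d z (2 ^ N * R)) ≤ ENNReal.ofReal cμ ^ N * μ (ball d z R) := by
  induction N with
  | zero => simp
  | succ n ih =>
    calc μ (ball d z (2 ^ (n + 1) * R)) = μ (ball d z (2 * (2 ^ n * R))) := by
          congr 2; ring
      _ ≤ ENNReal.ofReal cμ * μ (ball d z (2 ^ n * R)) := h.doubling _ _ (by positivity)
      _ ≤ ENNReal.ofReal cμ * (ENNReal.ofReal cμ ^ n * μ (ball d z R)) := by gcongr
      _ = _ := by ring

/-- The Vitali enlargement of the outer ball lies in the 2^N-fold dilate of the inner ball. Doubling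
N times and then sparseness compare its measure with μ(E), so only the ratio bound κ enters, not the
scale of the cube. -/
theorem IsHomogeneousType.exists_isSparseFamily (h : IsHomogeneousType d μ cd cμ) (hcd : 1 ≤ cd)
    {κ : ℝ} {N : ℕ} (hN : 5 * cd ^ 2 * κ ≤ 2 ^ N) {c₀ C₀ δ η : ℝ} (hc₀ : 0 < c₀)
    (hcC : c₀ ≤ C₀) (hκ : C₀ ≤ κ * c₀) (hδ : 0 < δ) (hη : 0 < η) {Q : ι → Set S}
    (hQ : ∀ i, IsCube d c₀ C₀ δ (Q i)) (hS : IsSparse μ η Q) :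
    ∃ (z : ι → S) (R : ι → ℝ) (E : ι → Set S), (∀ i, 0 < R i) ∧
      IsSparseFamily μ (ENNReal.ofReal cμ ^ N / ENNReal.ofReal η) Q
        (fun i => ball d (z i) (R i)) E := by
  have hex : ∀ i, ∃ (k : ℤ) (z : S), MeasurableSet (Q i) ∧ ball d z (c₀ * δ ^ k) ⊆ Q i ∧
      Q i ⊆ ball d z (C₀ * δ ^ k) := fun i => by
    obtain ⟨D, hD, k, hk⟩ := hQ i
    obtain ⟨z, hz⟩ := hD.sandwich k _ hk
    exact ⟨k, z, hD.measurableSet k _ hk, hz⟩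
  choose k z hm hin hout using hex
  obtain ⟨E, hEm, hEQ, hEη, hEd⟩ := hS
  have hC₀ : 0 < C₀ := hc₀.trans_le hcC
  have hδk : ∀ i, 0 < δ ^ k i := fun i => zpow_pos hδ _
  have hr : ∀ i, 0 < c₀ * δ ^ k i := fun i => mul_pos hc₀ (hδk i)
  have hR : ∀ i, 0 < C₀ * δ ^ k i := fun i => mul_pos hC₀ (hδk i)
  have hcd0 : 0 < cd := by linarith
  have hR' : ∀ i, 0 < 5 * cd ^ 2 * (C₀ * δ ^ k i) := fun i => by
    have := hR i
    positivity
  refine ⟨z, fun i => 5 * cd ^ 2 * (C₀ * δ ^ k i), E, hR', hEm, hm,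
    fun i => h.measurableSet_ball _ _, hEQ, fun i x hx => ?_, hEd,
    h.quasiMetric.hasVitaliCovering hcd hR (fun i => ?_) hout,
    fun i => (h.measure_ball_pos _ _ (hR' i)).ne', fun i => (h.measure_ball_lt_top _ _ (hR' i)).ne,
    fun i => ?_⟩
  · have h1 : d (z i) x < C₀ * δ ^ k i := hout i hx
    change d (z i) x < 5 * cd ^ 2 * (C₀ * δ ^ k i)
    have h2 : 1 ≤ cd ^ 2 := one_le_pow₀ hcd
    nlinarith [hR i]
  · exact ⟨z i, hin i (by
      change d (z i) (z i) < _
      rw [(h.quasiMetric.eq_zero_iff _ _).2 rfl]; exact hr i)⟩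
  · have hη' : ENNReal.ofReal η ≠ 0 := by simpa using hη
    have hsub : ball d (z i) (5 * cd ^ 2 * (C₀ * δ ^ k i)) ⊆
        ball d (z i) (2 ^ N * (c₀ * δ ^ k i)) := fun x hx => by
      refine lt_of_lt_of_le (show d (z i) x < _ from hx) ?_
      calc 5 * cd ^ 2 * (C₀ * δ ^ k i) ≤ 5 * cd ^ 2 * (κ * c₀ * δ ^ k i) := by
            have := hδk i
            gcongr
        _ = 5 * cd ^ 2 * κ * (c₀ * δ ^ k i) := by ring
        _ ≤ _ := by
            have := hr i
            gcongr
    calc μ (ball d (z i) (5 * cd ^ 2 * (C₀ * δ ^ k i)))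
        ≤ μ (ball d (z i) (2 ^ N * (c₀ * δ ^ k i))) := measure_mono hsub
      _ ≤ ENNReal.ofReal cμ ^ N * μ (ball d (z i) (c₀ * δ ^ k i)) :=
          h.measure_ball_two_pow_mul_le _ (hr i) N
      _ ≤ ENNReal.ofReal cμ ^ N * μ (Q i) := by gcongr; exact hin i
      _ = ENNReal.ofReal cμ ^ N / ENNReal.ofReal η * (ENNReal.ofReal η * μ (Q i)) := by
          rw [← mul_assoc, ENNReal.div_mul_cancel hη' ENNReal.ofReal_ne_top]
      _ ≤ _ := by gcongr; exact hEη i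

/-- The disjoint sets E all have positive measure, because μ(B) ≤ D μ(E) and μ(B) > 0. -/
theorem IsSparseFamily.countable [SFinite μ] {D : ℝ≥0∞} {Q B E : ι → Set S}
    (hF : IsSparseFamily μ D Q B E) : Countable ι := by
  have h := Measure.countable_meas_pos_of_disjoint_iUnion (μ := μ) hF.measurableSet_left
    hF.disjoint
  have huniv : {i | 0 < μ (E i)} = Set.univ := Set.eq_univ_of_forall fun i => by
    change 0 < μ (E i)
    refine pos_iff_ne_zero.2 fun h0 => hF.measure_ne_zero i ?_
    have := hF.measure_le i
    rwa [h0, mul_zero, nonpos_iff_eq_zero] at this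
  rw [huniv] at h
  exact Set.countable_univ_iff.1 h

theorem IsWeight.aemeasurable {w : S → ℝ}
    (hw : IsWeight d μ w) : AEMeasurable w μ := by
  rcases isEmpty_or_nonempty S with hS | ⟨⟨s⟩⟩
  · rw [Measure.eq_zero_of_isEmpty μ]; exact aemeasurable_zero_measure
  · have hu : ⋃ n : ℕ, ball d s (n + 1) = Set.univ := Set.eq_univ_of_forall fun x => by
      obtain ⟨n, hn⟩ := exists_nat_gt (d s x)
      exact Set.mem_iUnion.2 ⟨n, show d s x < n + 1 by linarith⟩
    rw [← Measure.restrict_univ (μ := μ), ← hu]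
    exact (aestronglyMeasurable_iUnion_iff.2 fun n : ℕ =>
      (hw.2 s (n + 1) (by positivity)).aestronglyMeasurable).aemeasurable

/-- A weight is only a.e. measurable. This replacement leaves all its integrals unchanged and may be
inverted at every point. -/
theorem exists_measurable_pos_version {v : S → ℝ≥0∞} (hv : AEMeasurable v μ)
    (h0 : ∀ x, v x ≠ 0) (ht : ∀ x, v x ≠ ∞) :
    ∃ W : S → ℝ≥0∞, Measurable W ∧ (∀ x, W x ≠ 0) ∧ (∀ x, W x ≠ ∞) ∧ v =ᵐ[μ] W := by
  classical
  have hm : MeasurableSet {x | hv.mk v x = 0 ∨ hv.mk v x = ∞} :=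
    (hv.measurable_mk (measurableSet_singleton 0)).union
      (hv.measurable_mk (measurableSet_singleton ∞))
  refine ⟨fun x => if hv.mk v x = 0 ∨ hv.mk v x = ∞ then 1 else hv.mk v x,
    Measurable.ite hm measurable_const hv.measurable_mk, fun x => ?_, fun x => ?_, ?_⟩
  · dsimp only
    split_ifs with h
    · simp
    · exact fun h' => h (Or.inl h')
  · dsimp only
    split_ifs with h
    · simp
    · exact fun h' => h (Or.inr h')
  · filter_upwards [hv.ae_eq_mk] with x hx
    rw [← hx, if_neg (by simp [h0, ht])]

end Geometry

/-! ### Reduction to averages of |f|^{p₀} and conclusion. -/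

theorem sparseOp_rpow_le {𝕜 : Type*} [RCLike 𝕜] {μ : Measure S} {p₀ r p ρ : ℝ} (hp₀ : 0 < p₀)
    (hr : 0 < r) (hp : 0 < p) (hρ : 0 < ρ) (hρr : ρ ≤ r / p₀) (Q : ι → Set S) {f : S → 𝕜}
    {g : S → ℝ≥0∞} (hg : ∀ᵐ x ∂μ, ‖f x‖ₑ ^ p₀ = g x) (x : S) :
    sparseOp μ p₀ r Q f x ^ p ≤
      (∑' i, (Q i).indicator (fun _ => ((∫⁻ y in Q i, g y ∂μ) / μ (Q i)) ^ ρ) x)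
        ^ (p / p₀ / ρ) := by
  classical
  have hu : 0 < r / p₀ := div_pos hr hp₀
  set b : ι → ℝ≥0∞ := fun i =>
    (Q i).indicator (fun _ => (∫⁻ y in Q i, g y ∂μ) / μ (Q i)) x with hb
  have hbpow : ∀ v : ℝ, 0 < v → ∀ i,
      (Q i).indicator (fun _ => ((∫⁻ y in Q i, g y ∂μ) / μ (Q i)) ^ v) x = b i ^ v := by
    intro v hv i
    by_cases hx : x ∈ Q i
    · simp [hb, hx]
    · simp [hb, hx, hv]
  have hop : sparseOp μ p₀ r Q f x = (∑' i, b i ^ (r / p₀)) ^ (1 / r) := by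
    rw [sparseOp]
    congr 1
    refine tsum_congr fun i => ?_
    rw [← hbpow _ hu i, Set.indicator_apply]
    congr 1
    rw [avg, lintegral_congr_ae (ae_restrict_of_ae hg), ← ENNReal.rpow_mul]
    congr 1
    field_simp
  have h1 := tsum_rpow_rpow_le_of_exponent_le b hρ hρr
  simp only [hbpow ρ hρ]
  calc sparseOp μ p₀ r Q f x ^ p = ((∑' i, b i ^ (r / p₀)) ^ (1 / (r / p₀))) ^ (p / p₀) := by
        rw [hop, ← ENNReal.rpow_mul, ← ENNReal.rpow_mul]
        congr 1
        field_simp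
    _ ≤ ((∑' i, b i ^ ρ) ^ (1 / ρ)) ^ (p / p₀) := by gcongr
    _ = _ := by
        rw [← ENNReal.rpow_mul]
        congr 1
        field_simp

end HomType

theorem proposition4p1 {𝕜 : Type*} [RCLike 𝕜]
    (cd cμ κ p₀ r p η : ℝ) (hcd : 1 ≤ cd) (hcμ : 1 ≤ cμ) (hκ : 1 ≤ κ)
    (hp₀ : 1 ≤ p₀) (hr : 1 ≤ r) (hp : p₀ < p) (hη : 0 < η) :
    ∃ C : ℝ≥0, ∀ (S : Type*) [MeasurableSpace S] (d : S → S → ℝ) (μ : Measure S),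
      HomType.IsHomogeneousType d μ cd cμ →
      ∀ (c₀ C₀ δ : ℝ), 0 < c₀ → c₀ ≤ C₀ → C₀ ≤ κ * c₀ → 0 < δ → δ < 1 →
      ∀ (ι : Type*) (Q : ι → Set S),
        (∀ i, HomType.IsCube d c₀ C₀ δ (Q i)) → HomType.IsSparse μ η Q →
      ∀ w : S → ℝ, HomType.MemAp d μ (p / p₀) w →
      ∀ f : S → 𝕜, MemLp f (ENNReal.ofReal p) (HomType.weighted μ w) →
        eLpNorm (HomType.sparseOp μ p₀ r Q f) (ENNReal.ofReal p) (HomType.weighted μ w) ≤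
          C * HomType.apChar d μ (p / p₀) w ^ max (1 / (p - p₀)) (1 / r) *
            eLpNorm f (ENNReal.ofReal p) (HomType.weighted μ w) := by
  open HomType in
  have hp₀0 : 0 < p₀ := by linarith
  have hp0 : 0 < p := by linarith
  have hr0 : 0 < r := by linarith
  have hpp : 0 < p - p₀ := by linarith
  obtain ⟨N, hN⟩ := pow_unbounded_of_one_lt (5 * cd ^ 2 * κ) (one_lt_two (α := ℝ))
  set t := p / p₀ with htdef
  have ht : 1 < t := (one_lt_div hp₀0).2 hp
  have ht1 : 0 < t - 1 := by linarith
  -- The bound r/p₀ permits the passage to a smaller ℓ exponent; the bound t - 1 is what the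
  -- single-cube estimate needs.
  set ρ := min (r / p₀) (t - 1) with hρdef
  have hρ : 0 < ρ := lt_min (div_pos hr0 hp₀0) ht1
  have hρr : ρ ≤ r / p₀ := min_le_left _ _
  have hρt : ρ ≤ t - 1 := min_le_right _ _
  set m := max (1 / (p - p₀)) (1 / r) with hmdef
  have hm0 : 0 < m := lt_max_of_lt_right (by positivity)
  -- This is where the maximum arises: ρ p₀ = min(r, p - p₀), and the exponent is its reciprocal.
  have hρm : t / ρ * (1 / p) = m := by
    have h1 : ρ * p₀ = min r (p - p₀) := by
      rw [hρdef, min_mul_of_nonneg _ _ hp₀0.le, htdef]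
      congr 1 <;> field_simp
    have h2 : t / ρ * (1 / p) = 1 / (ρ * p₀) := by
      rw [htdef]; field_simp
    rw [h2, h1, hmdef]
    rcases le_total r (p - p₀) with h | h
    · rw [min_eq_left h, max_eq_right (one_div_le_one_div_of_le hr0 h)]
    · rw [min_eq_right h, max_eq_left (one_div_le_one_div_of_le hpp h)]
  set D : ℝ≥0∞ := ENNReal.ofReal cμ ^ N / ENNReal.ofReal η with hD
  have hDt : D ≠ ∞ :=
    ENNReal.div_ne_top (ENNReal.pow_ne_top ENNReal.ofReal_ne_top) (by simpa using hη)
  have hK : sparseConst t ρ D ^ m ≠ ∞ :=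
    ENNReal.rpow_ne_top_of_nonneg hm0.le (sparseConst_ne_top hρ hρt hDt)
  refine ⟨(sparseConst t ρ D ^ m).toNNReal, ?_⟩
  intro S _ d μ hS c₀ C₀ δ hc₀ hcC hCκ hδ _ ι Q hQ hsp w hw f hf
  have hσ := hS.sigmaFinite
  obtain ⟨z, R, E, hR, hF⟩ := hS.exists_isSparseFamily hcd hN.le hc₀ hcC hCκ hδ hη hQ hsp
  have hcount := hF.countable
  have hwm : AEMeasurable (fun x => ENNReal.ofReal (w x)) μ :=
    hw.1.aemeasurable.ennreal_ofReal
  obtain ⟨W, hW, hW0, hWt, hWw⟩ := exists_measurable_pos_version hwm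
    (fun x => by simpa using hw.1.1 x) fun x => ENNReal.ofReal_ne_top
  have hweq : weighted μ w = μ.withDensity W := withDensity_congr_ae hWw
  -- Measurability of f is given only for w dμ; positivity of w transfers it to μ.
  have hac : μ ≪ weighted μ w :=
    withDensity_absolutelyContinuous' hwm
      (Filter.Eventually.of_forall fun x => by simpa using hw.1.1 x)
  have hfm : AEMeasurable (fun x => ‖f x‖ₑ) μ := (hf.1.mono_ac hac).enorm
  obtain ⟨φ, hφ, hfφ⟩ := hfm
  have hg : ∀ᵐ x ∂μ, ‖f x‖ₑ ^ p₀ = φ x ^ p₀ := by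
    filter_upwards [hfφ] with x hx
    rw [hx]
  have hgW : ∫⁻ x, (φ x ^ p₀) ^ t * W x ∂μ = ∫⁻ x, ‖f x‖ₑ ^ p ∂weighted μ w := by
    have hac' : weighted μ w ≪ μ := withDensity_absolutelyContinuous _ _
    rw [lintegral_congr_ae (g := fun x => φ x ^ p)
      (hac'.ae_le (by filter_upwards [hfφ] with x hx; rw [hx])), hweq,
      lintegral_withDensity_eq_lintegral_mul _ hW (by fun_prop)]
    refine lintegral_congr fun x => ?_
    rw [← ENNReal.rpow_mul, htdef, mul_div_cancel₀ _ hp₀0.ne', mul_comm]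
    rfl
  have hpo : ENNReal.ofReal p ≠ 0 := by simpa using hp0
  have hfin : ∫⁻ x, ‖f x‖ₑ ^ p ∂weighted μ w ≠ ∞ := by
    have := lintegral_rpow_enorm_lt_top_of_eLpNorm_lt_top hpo ENNReal.ofReal_ne_top hf.2
    rw [ENNReal.toReal_ofReal hp0.le] at this
    exact this.ne
  have hball : ∀ i, ∫⁻ x in ball d (z i) (R i), ENNReal.ofReal (w x) ∂μ
      = μ.withDensity W (ball d (z i) (R i)) := fun i => by
    rw [withDensity_apply _ (hF.measurableSet_right i)]
    exact lintegral_congr_ae (ae_restrict_of_ae hWw)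
  have hwB : ∀ i, μ.withDensity W (ball d (z i) (R i)) ≠ ∞ := fun i => by
    rw [← hball i]
    exact (hw.1.2 (z i) (R i) (hR i)).lintegral_lt_top.ne
  have hA : ∀ i, μ.withDensity W (ball d (z i) (R i)) / μ (ball d (z i) (R i)) *
      (dualMeasure μ t W (ball d (z i) (R i)) / μ (ball d (z i) (R i))) ^ (t - 1)
        ≤ apChar d μ t w := fun i => by
    have h1 : avg μ 1 (ball d (z i) (R i)) (fun x => ENNReal.ofReal (w x)) *
        avg μ (1 / (t - 1)) (ball d (z i) (R i)) (fun x => (ENNReal.ofReal (w x))⁻¹)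
          ≤ apChar d μ t w := by
      refine le_trans (le_of_eq ?_)
        (le_iSup_of_le (z i) (le_iSup_of_le (R i) (le_iSup_of_le (hR i) le_rfl)))
      rw [if_neg ht.ne']
    refine le_trans (le_of_eq ?_) h1
    have h2 : ∫⁻ x in ball d (z i) (R i), (ENNReal.ofReal (w x))⁻¹ ^ (1 / (t - 1)) ∂μ
        = dualMeasure μ t W (ball d (z i) (R i)) := by
      rw [dualMeasure, withDensity_apply _ (hF.measurableSet_right i)]
      refine lintegral_congr_ae (ae_restrict_of_ae ?_)
      filter_upwards [hWw] with x hx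
      rw [hx]
    simp only [avg, ENNReal.rpow_one, one_div_one_div, h2, hball, div_one]
  have hmain := lintegral_tsum_indicator_rpow_le hF hρ hρt hW hW0 hWt hwB hw.2.ne hA
    (g := fun x => φ x ^ p₀) (by fun_prop) (by rw [hgW]; exact hfin)
  rw [hgW, ← hweq] at hmain
  rw [eLpNorm_eq_lintegral_rpow_enorm_toReal hpo ENNReal.ofReal_ne_top,
    eLpNorm_eq_lintegral_rpow_enorm_toReal hpo ENNReal.ofReal_ne_top,
    ENNReal.toReal_ofReal hp0.le, ENNReal.coe_toNNReal hK]
  calc (∫⁻ x, ‖sparseOp μ p₀ r Q f x‖ₑ ^ p ∂weighted μ w) ^ (1 / p)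
      ≤ ((sparseConst t ρ D * apChar d μ t w) ^ (t / ρ) *
          ∫⁻ x, ‖f x‖ₑ ^ p ∂weighted μ w) ^ (1 / p) := by
        gcongr
        refine le_trans (lintegral_mono fun x => ?_) hmain
        exact sparseOp_rpow_le hp₀0 hr0 hp0 hρ hρr Q hg x
    _ = _ := by
        rw [ENNReal.mul_rpow_of_nonneg _ _ (by positivity), ← ENNReal.rpow_mul, hρm,
          ENNReal.mul_rpow_of_nonneg _ _ hm0.le]
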